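/- Let $q$ be a power of an odd prime and let $\widehat{\mathbb F_q^\times}$ be the group of multiplicative characters $\chi:\mathbb F_q^\times\to\mathbb C^\times$, each (including the trivial character $\varepsilon$) extended to $\mathbb F_q$ by $\chi(0)=0$. Write $\overline\chi=\chi^{-1}$, let $\phi$ be the quadratic character, and let $J(\chi,\psi)=\sum_{y\in\mathbb F_q}\chi(y)\psi(1-y)$. For $A_i,B_j\in\widehat{\mathbb F_q^\times}$ and $\lambda\in\mathbb F_q$ put ${}_1\mathbb P_0[A_1;\lambda]=\overline{A_1}(1-\lambda)$ and, for $n\ge 1$, $${}_{n+1}\mathbb P_n\left[\begin{matrix}A_1&\cdots&A_{n+1}\\&B_1\ \cdots&B_n\end{matrix};\lambda\right]=\sum_{y\in\mathbb F_q}A_{n+1}(y)\,\overline{A_{n+1}}B_n(1-y)\;{}_n\mathbb P_{n-1}\left[\begin{matrix}A_1&\cdots&A_n\\&B_1\ \cdots&B_{n-1}\end{matrix};\lambda y\right],$$ $${}_{n+1}\mathbb F_n\left[\begin{matrix}A_1&\cdots&A_{n+1}\\&B_1\ \cdots&B_n\end{matrix};\lambda\right]=\frac{1}{\prod_{i=1}^nJ(A_{i+1},B_i\overline{A_{i+1}})}\;{}_{n+1}\mathbb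 P_n\left[\begin{matrix}A_1&\cdots&A_{n+1}\\&B_1\ \cdots&B_n\end{matrix};\lambda\right].$$ **Theorem.** Let $A,B\in\widehat{\mathbb F_q^\times}$ be such that none of $A$, $B$, $B^2\overline A$, $B^3\overline A^2$, $B^3\phi\overline A$ is trivial, and let $x\in\mathbb F_q$ with $x\ne\pm1$ and $x\neq\frac12$. Then $${}_3\mathbb F_2\left[\begin{matrix}A&B&A\phi\overline B\\&B^2&A^2\overline B^2\end{matrix};4x(1-x)\right]=\overline A^2(1-x)\;{}_3\mathbb F_2\left[\begin{matrix}A&B&A\phi\overline B\\&B^2&A^2\overline B^2\end{matrix};\frac{-4x}{(1-x)^2}\right].$$ -/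

import Mathlib

/-- The quadratic character `φ` of a finite field, with values in `ℂ`. -/
noncomputable def phi (F : Type*) [Field F] [Fintype F] [DecidableEq F] : MulChar F ℂ :=
  (quadraticChar F).ringHomComp (Int.castRingHom ℂ)

/-- The period function `ₙ₊₁ℙₙ[A₁, …, Aₙ₊₁; B₁, …, Bₙ; x]` over a finite field `F`. The characters
are indexed from `0`, so `A i` is `Aᵢ₊₁` and `B i` is `Bᵢ₊₁`. Every multiplicative character,
including the trivial one, takes the value `0` at `0`. -/
noncomputable def periodP {F : Type*} [Field F] [Fintype F] :
    (n : ℕ) → (Fin (n + 1) → MulChar F ℂ) → (Fin n → MulChar F ℂ) → F → ℂ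
  | 0, A, _, x => (A 0)⁻¹ (1 - x)
  | n + 1, A, B, x =>
      ∑ y : F, A (Fin.last (n + 1)) y * ((A (Fin.last (n + 1)))⁻¹ * B (Fin.last n)) (1 - y) *
        periodP n (fun i => A i.castSucc) (fun i => B i.castSucc) (x * y)

/-- The normalized hypergeometric function `ₙ₊₁𝔽ₙ[A₁, …, Aₙ₊₁; B₁, …, Bₙ; x]` over `F`: the period
function divided by `∏ᵢ J(Aᵢ₊₁, Bᵢ Āᵢ₊₁)`. -/
noncomputable def hypergeomF {F : Type*} [Field F] [Fintype F] (n : ℕ)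
    (A : Fin (n + 1) → MulChar F ℂ) (B : Fin n → MulChar F ℂ) (x : F) : ℂ :=
  1 / (∏ i : Fin n, jacobiSum (A i.succ) (B i * (A i.succ)⁻¹)) * periodP n A B x

open AddChar

/-! ### Gauss sums and a quadratic transformation of a `₂F₁`-type sum. -/

section CharacterSums

variable {F : Type*} [Field F]

/-! With `C = AφB̄`, both lower parameters are squares `B²`, `C²`, so the period is `squarePeriod`,
whose inner sum is a `₂F₁` sum with parameters `A, C; C²`. Fourier expansion
(`exists_quadratic_transformation`) rewrites that inner sum. At `t = 4x(1-x)` the factorization `r +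
x(1-x)(r-1)² = ((1-x)r+x)(xr+1-x)` then turns the whole period into a constant times `(BĀ)(x(1-x))`
times `dualLineSum` (`exists_squarePeriod_eq`). Exchanging the two variables of `dualLineSum`
replaces `x` by `1/x` up to a character value (`dualLineSum_inv`). The points `1-x` and `1/(1-x)`
give `t = 4x(1-x)` and `t = -4x/(1-x)²`, so comparing them proves the theorem; the constant does not
depend on `x` and needs no evaluation. -/

theorem mulChar_mul_inv_self {χ : MulChar F ℂ} {a : F} (ha : a ≠ 0) : χ a * χ⁻¹ a = 1 := by
  rw [← MulChar.mul_apply, mul_inv_cancel, MulChar.one_apply (isUnit_iff_ne_zero.mpr ha)]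

variable [Fintype F]

theorem gaussSum_ne_zero' {χ : MulChar F ℂ} (hχ : χ ≠ 1) {ψ : AddChar F ℂ}
    (hψ : ψ.IsPrimitive) : gaussSum χ ψ ≠ 0 :=
  gaussSum_ne_zero_of_nontrivial (by simp) hχ hψ

/-- The Fourier transform of a nontrivial multiplicative character. -/
theorem sum_mulChar_mul_addChar {χ : MulChar F ℂ} (hχ : χ ≠ 1) (ψ : AddChar F ℂ) (a : F) :
    ∑ k, χ k * ψ (a * k) = χ⁻¹ a * gaussSum χ ψ := by
  rcases eq_or_ne a 0 with rfl | ha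
  · simp [MulChar.sum_eq_zero_of_ne_one hχ, MulChar.map_zero]
  · exact gaussSum_mulShift_eq χ ψ (Units.mk0 a ha)

theorem sum_addChar_mul_left {ψ : AddChar F ℂ} (hψ : ψ.IsPrimitive) {a : F} (ha : a ≠ 0) :
    ∑ k, ψ (a * k) = 0 :=
  sum_eq_zero_of_ne_one (hψ ha)

/-- Every multiplicative character is, up to an additive constant, a nonzero multiple of the Fourier
transform of its inverse. -/
theorem exists_mulChar_eq_sum (χ : MulChar F ℂ) {ψ : AddChar F ℂ} (hψ : ψ.IsPrimitive) :
    ∃ c d : ℂ, ∀ a, χ a = c * ∑ k, χ⁻¹ k * ψ (a * k) + d := by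
  classical
  rcases eq_or_ne χ 1 with rfl | hχ
  · have hq : (Fintype.card F : ℂ) ≠ 0 := by simp
    -- The transform of the trivial character is `q - 1` at `0` and `-1` elsewhere; `c`, `d` send
    -- these values to `0` and `1`.
    refine ⟨-(Fintype.card F : ℂ)⁻¹, 1 - (Fintype.card F : ℂ)⁻¹, fun a => ?_⟩
    have h1 : ∀ f : F → ℂ, ∑ k, (1 : MulChar F ℂ)⁻¹ k * f k = ∑ k, f k - f 0 := by
      intro f
      rw [eq_sub_iff_add_eq, ← Finset.sum_erase_add _ _ (Finset.mem_univ (0 : F)),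
        ← Finset.sum_erase_add Finset.univ f (Finset.mem_univ (0 : F))]
      simp only [inv_one, MulChar.map_zero, zero_mul, add_zero]
      congr 1
      refine Finset.sum_congr rfl fun k hk => ?_
      rw [MulChar.one_apply (isUnit_iff_ne_zero.mpr (Finset.ne_of_mem_erase hk)), one_mul]
    rw [h1]
    rcases eq_or_ne a 0 with rfl | ha
    · simp only [MulChar.map_zero, zero_mul, map_zero_eq_one, mul_zero, Finset.sum_const,
        Finset.card_univ, nsmul_eq_mul, mul_one]
      field_simp
      ring
    · rw [sum_addChar_mul_left hψ ha, MulChar.one_apply (isUnit_iff_ne_zero.mpr ha)]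
      simp
  · refine ⟨(gaussSum χ⁻¹ ψ)⁻¹, 0, fun a => ?_⟩
    have h := gaussSum_ne_zero' (inv_ne_one.mpr hχ) hψ
    rw [sum_mulChar_mul_addChar (inv_ne_one.mpr hχ), inv_inv, add_zero]
    field_simp

theorem sum_comp_add_right (f : F → ℂ) (a : F) : ∑ u, f (u + a) = ∑ u, f u :=
  Equiv.sum_comp (Equiv.addRight a) f

theorem sum_comp_one_sub (f : F → ℂ) : ∑ u, f (1 - u) = ∑ u, f u :=
  Equiv.sum_comp (Equiv.subLeft (1 : F)) f

theorem sum_comp_mul_left (f : F → ℂ) {a : F} (ha : a ≠ 0) : ∑ u, f (a * u) = ∑ u, f u :=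
  Equiv.sum_comp (Equiv.mulLeft₀ a ha) f

variable [DecidableEq F]

theorem phi_mul_phi : phi F * phi F = 1 := by
  rw [phi, ← MulChar.ringHomComp_mul, ← sq, (quadraticChar_isQuadratic F).sq_eq_one,
    MulChar.ringHomComp_one]

theorem sum_comp_sq (hF : ringChar F ≠ 2) (f : F → ℂ) :
    ∑ u, f (u ^ 2) = ∑ t, (phi F t + 1) * f t := by
  rw [← Finset.sum_fiberwise (s := Finset.univ) (g := fun u : F => u ^ 2)]
  refine Finset.sum_congr rfl fun t _ => ?_
  have h := quadraticChar_card_sqrts hF t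
  have hc : ((Finset.univ.filter fun u : F => u ^ 2 = t).card : ℂ) = phi F t + 1 := by
    have h2 : (Finset.univ.filter fun u : F => u ^ 2 = t) = {x : F | x ^ 2 = t}.toFinset := by
      ext; simp
    rw [h2, phi, MulChar.ringHomComp_apply]
    have := congrArg (Int.cast : ℤ → ℂ) h
    push_cast at this
    simpa using this
  rw [← hc, ← nsmul_eq_mul, ← Finset.sum_const]
  refine Finset.sum_congr rfl fun u hu => ?_
  rw [(Finset.mem_filter.mp hu).2]

theorem phi_ne_one (hF : ringChar F ≠ 2) : phi F ≠ 1 := by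
  intro h
  obtain ⟨a, ha⟩ := quadraticChar_exists_neg_one hF
  have ha0 : a ≠ 0 := by rintro rfl; simp at ha
  have := congrArg (fun χ : MulChar F ℂ => χ a) h
  simp only [phi, MulChar.ringHomComp_apply, ha,
    MulChar.one_apply (isUnit_iff_ne_zero.mpr ha0)] at this
  norm_num at this

theorem phi_inv : (phi F)⁻¹ = phi F :=
  inv_eq_of_mul_eq_one_left phi_mul_phi

theorem sum_addChar_quadratic (hF : ringChar F ≠ 2) {ψ : AddChar F ℂ} (hψ : ψ.IsPrimitive)
    {k : F} (hk : k ≠ 0) (l : F) :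
    ∑ u, ψ (-k * u ^ 2 + l * u) = phi F (-k) * gaussSum (phi F) ψ * ψ (l ^ 2 / (4 * k)) := by
  have h2 := Ring.two_ne_zero hF
  have h4 : (4 : F) ≠ 0 := by convert mul_ne_zero h2 h2 using 1; norm_num
  rw [← sum_comp_add_right _ (l / (2 * k))]
  have h : ∀ u : F, ψ (-k * (u + l / (2 * k)) ^ 2 + l * (u + l / (2 * k))) = ψ (-k * u ^ 2) * ψ (l ^ 2 / (4 * k)) := by
    intro u
    rw [← map_add_eq_mul]
    congr 1
    field_simp
    ring
  simp_rw [h, ← Finset.sum_mul]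
  rw [sum_comp_sq hF (fun t => ψ (-k * t))]
  simp_rw [add_mul, one_mul, Finset.sum_add_distrib]
  rw [sum_addChar_mul_left hψ (neg_ne_zero.mpr hk), sum_mulChar_mul_addChar (phi_ne_one hF),
    phi_inv, add_zero]

/-- A finite field analogue of the two integral representations of the Bessel function. -/
theorem exists_bessel (hF : ringChar F ≠ 2) (C : MulChar F ℂ) {ψ : AddChar F ℂ}
    (hψ : ψ.IsPrimitive) :
    ∃ κ : ℂ, ∀ l : F, l ≠ 0 → ∑ u, C (1 - u ^ 2) * ψ (l * u) =
      κ * ∑ k, (C⁻¹ * phi F) k * ψ (k + l ^ 2 / (4 * k)) := by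
  obtain ⟨c, d, h⟩ := exists_mulChar_eq_sum C hψ
  refine ⟨c * phi F (-1) * gaussSum (phi F) ψ, fun l hl => ?_⟩
  simp_rw [h, add_mul, Finset.sum_add_distrib, mul_assoc c, ← Finset.mul_sum]
  -- Since `l ≠ 0`, the additive constant `d` drops out, so a trivial `C` is allowed.
  rw [sum_addChar_mul_left hψ hl, mul_zero, add_zero]
  congr 1
  simp_rw [Finset.sum_mul, Finset.mul_sum]
  rw [Finset.sum_comm]
  refine Finset.sum_congr rfl fun k _ => ?_
  rcases eq_or_ne k 0 with rfl | hk
  · simp [MulChar.map_zero]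
  have h1 : ∀ u : F, C⁻¹ k * ψ ((1 - u ^ 2) * k) * ψ (l * u) =
      C⁻¹ k * ψ k * ψ (-k * u ^ 2 + l * u) := by
    intro u
    rw [mul_assoc, mul_assoc, ← map_add_eq_mul, ← map_add_eq_mul]
    congr 2
    ring
  simp_rw [h1, ← Finset.mul_sum]
  rw [sum_addChar_quadratic hF hψ hk, map_add_eq_mul, MulChar.mul_apply,
    show phi F (-k) = phi F (-1) * phi F k by rw [← map_mul]; ring_nf]
  ring

/-- A quadratic transformation for the `₂F₁` sum with parameters `A, C; C²`. -/
theorem exists_quadratic_transformation (hF : ringChar F ≠ 2) {A B C : MulChar F ℂ}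
    (hA : A ≠ 1) (hB : B ≠ 1) (hABC : A = B * C * phi F) :
    ∃ κ : ℂ, ∀ ν : F, ν ≠ 0 → ∑ u, C (u * (1 - u)) * A⁻¹ (1 - 4 * ν * u) =
      κ * (B * A⁻¹) ν * ∑ r, A r * B⁻¹ (r + ν * (r - 1) ^ 2) := by
  have h2 := Ring.two_ne_zero hF
  have h4 : (4 : F) ≠ 0 := by convert mul_ne_zero h2 h2 using 1; norm_num
  obtain ⟨ψ, hψ⟩ : ∃ ψ : AddChar F ℂ, ψ.IsPrimitive :=
    ⟨_, FiniteField.primitiveChar_to_Complex_isPrimitive F⟩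
  obtain ⟨κ, hκ⟩ := exists_bessel hF C hψ
  have gA := gaussSum_ne_zero' hA hψ
  have gB := gaussSum_ne_zero' hB hψ
  have hBA : C⁻¹ * phi F = B * A⁻¹ := by
    rw [hABC, mul_inv, mul_inv, phi_inv]
    group
  refine ⟨κ * C⁻¹ 4 * gaussSum B ψ / gaussSum A ψ, fun ν hν => ?_⟩
  -- The Gauss sum linearizes `A⁻¹`; the substitution is `v = 1 - 2u`.
  have e1 : (∑ u, C (u * (1 - u)) * A⁻¹ (1 - 4 * ν * u)) * gaussSum A ψ =
      C⁻¹ 4 * ∑ l, A l * ψ ((1 - 2 * ν) * l) * ∑ v, C (1 - v ^ 2) * ψ (2 * ν * l * v) := by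
    have hu : ∑ u, C (u * (1 - u)) * A⁻¹ (1 - 4 * ν * u) =
        C⁻¹ 4 * ∑ v, C (1 - v ^ 2) * A⁻¹ (1 - 2 * ν + 2 * ν * v) := by
      rw [Finset.mul_sum, ← sum_comp_one_sub fun v => C⁻¹ 4 * (C (1 - v ^ 2) * A⁻¹ (1 - 2 * ν + 2 * ν * v)),
        ← sum_comp_mul_left
          (fun v => C⁻¹ 4 * (C (1 - (1 - v) ^ 2) * A⁻¹ (1 - 2 * ν + 2 * ν * (1 - v)))) h2]
      refine Finset.sum_congr rfl fun u _ => ?_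
      rw [show (1 : F) - (1 - 2 * u) ^ 2 = 4 * (u * (1 - u)) by ring, map_mul C 4, ← mul_assoc,
        ← mul_assoc, mul_comm (C⁻¹ 4), mulChar_mul_inv_self h4, one_mul]
      congr 2
      ring
    rw [hu, mul_assoc, Finset.sum_mul]
    congr 1
    simp_rw [mul_assoc (C _), ← sum_mulChar_mul_addChar hA, Finset.mul_sum]
    rw [Finset.sum_comm]
    refine Finset.sum_congr rfl fun l _ => Finset.sum_congr rfl fun v _ => ?_
    rw [show (1 - 2 * ν + 2 * ν * v) * l = (1 - 2 * ν) * l + 2 * ν * l * v by ring,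
      map_add_eq_mul]
    ring
  have e2 : ∑ l, A l * ψ ((1 - 2 * ν) * l) * ∑ v, C (1 - v ^ 2) * ψ (2 * ν * l * v) =
      κ * ∑ k, ∑ l, (B * A⁻¹) k * A l * ψ ((1 - 2 * ν) * l + k + ν ^ 2 * l ^ 2 / k) := by
    rw [Finset.sum_comm, Finset.mul_sum]
    refine Finset.sum_congr rfl fun l _ => ?_
    rcases eq_or_ne l 0 with rfl | hl
    · simp [MulChar.map_zero]
    rw [hκ _ (mul_ne_zero (mul_ne_zero h2 hν) hl), hBA, Finset.mul_sum, Finset.mul_sum,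
      Finset.mul_sum]
    refine Finset.sum_congr rfl fun k _ => ?_
    rw [add_assoc, map_add_eq_mul _ ((1 - 2 * ν) * l),
      show (2 * ν * l) ^ 2 / (4 * k) = ν ^ 2 * l ^ 2 / k by
        rw [show (2 * ν * l) ^ 2 = 4 * (ν ^ 2 * l ^ 2) by ring, mul_div_mul_left _ _ h4]]
    ring
  -- Replacing `k` by `νk` and then setting `l = kr` makes the phase linear in `k`, so the sum over
  -- `k` is a Gauss sum of `B`.
  have e3 : ∑ k, ∑ l, (B * A⁻¹) k * A l * ψ ((1 - 2 * ν) * l + k + ν ^ 2 * l ^ 2 / k) =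
      (B * A⁻¹) ν * (∑ r, A r * B⁻¹ (r + ν * (r - 1) ^ 2)) * gaussSum B ψ := by
    rw [mul_assoc, Finset.sum_mul, ← sum_comp_mul_left _ hν]
    simp_rw [mul_assoc (A _), ← sum_mulChar_mul_addChar hB, Finset.mul_sum]
    rw [Finset.sum_comm (γ := F) (f := fun r k => _ * (A r * _))]
    refine Finset.sum_congr rfl fun k _ => ?_
    rcases eq_or_ne k 0 with rfl | hk
    · simp [MulChar.map_zero]
    rw [← sum_comp_mul_left _ hk]
    refine Finset.sum_congr rfl fun r _ => ?_
    rw [show (1 - 2 * ν) * (k * r) + ν * k + ν ^ 2 * (k * r) ^ 2 / (ν * k) =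
      (r + ν * (r - 1) ^ 2) * k by field_simp; ring]
    simp only [map_mul, MulChar.mul_apply]
    linear_combination (B ν * B k * A⁻¹ ν * A r * ψ ((r + ν * (r - 1) ^ 2) * k)) *
      mulChar_mul_inv_self (χ := A) hk
  rw [e2, e3] at e1
  rw [eq_div_of_mul_eq gA e1]
  ring

end CharacterSums

/-! ### Symmetry of `dualLineSum` and the transformation of the period. -/

section Transformation

variable {F : Type*} [Field F] [Fintype F]

/-- The Möbius map `z = w/(w-b)` takes every value except `1`, so the sum is the full sum of `B`
minus `B 1`. -/
theorem sum_mulChar_div_sub {B : MulChar F ℂ} (hB : B ≠ 1) {b : F} (hb : b ≠ 0) :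
    ∑ w, B w * B⁻¹ (w - b) = -1 := by
  classical
  have h : ∑ w, B w * B⁻¹ (w - b) + 1 = ∑ z, B z := by
    rw [← Finset.sum_erase_add Finset.univ B (Finset.mem_univ 1), map_one,
      ← Finset.sum_erase_add _ _ (Finset.mem_univ b), sub_self, MulChar.map_zero, mul_zero,
      add_zero]
    congr 1
    refine Finset.sum_bij' (fun w _ => w / (w - b)) (fun z _ => b * z / (z - 1)) ?_ ?_ ?_ ?_ ?_
    · intro w hw
      have hw' : w - b ≠ 0 := sub_ne_zero.mpr (Finset.ne_of_mem_erase hw)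
      refine Finset.mem_erase.mpr ⟨fun h => hb ?_, Finset.mem_univ _⟩
      rw [div_eq_one_iff_eq hw'] at h
      linear_combination h
    · intro z hz
      have hz' : z - 1 ≠ 0 := sub_ne_zero.mpr (Finset.ne_of_mem_erase hz)
      refine Finset.mem_erase.mpr ⟨fun h => hb ?_, Finset.mem_univ _⟩
      rw [div_eq_iff hz'] at h
      linear_combination h
    · intro w hw
      have hw' : w - b ≠ 0 := sub_ne_zero.mpr (Finset.ne_of_mem_erase hw)
      have : w / (w - b) - 1 = b / (w - b) := by field_simp; ring
      rw [this]
      field_simp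
    · intro z hz
      have hz' : z - 1 ≠ 0 := sub_ne_zero.mpr (Finset.ne_of_mem_erase hz)
      have : b * z / (z - 1) - b = b / (z - 1) := by field_simp; ring
      rw [this]
      field_simp
    · intro w hw
      have hw' : w - b ≠ 0 := sub_ne_zero.mpr (Finset.ne_of_mem_erase hw)
      rw [div_eq_mul_inv, map_mul, MulChar.inv_apply]
      simp
  rw [MulChar.sum_eq_zero_of_ne_one hB] at h
  linear_combination h

/-- A character sum over the projective plane, in which the coefficient vector `(1 - x, x, -1)` may
be permuted. -/
noncomputable def dualLineSum (B K : MulChar F ℂ) (x : F) : ℂ :=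
  ∑ r, ∑ w, B r * B w * B⁻¹ (w - x * r - (1 - x)) * K⁻¹ (r - ((1 - x) * r + x) * w)

/-- For nonzero `r`, `w`, the two linear factors are, up to units, the form `(1-x, x, -1)` evaluated
at `(1, r, w)` and at `(1, 1/r, 1/w)`. Swapping `r` and `w` gives `(1-x, -1, x)`, which is `-x`
times the form for `1/x`. -/
theorem dualLineSum_inv (B K : MulChar F ℂ) {x : F} (hx : x ≠ 0) :
    dualLineSum B K x⁻¹ = (B * K) (-x) * dualLineSum B K x := by
  unfold dualLineSum
  rw [Finset.sum_comm, Finset.mul_sum]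
  refine Finset.sum_congr rfl fun r _ => ?_
  rw [Finset.mul_sum]
  refine Finset.sum_congr rfl fun w _ => ?_
  have hx' := neg_ne_zero.mpr hx
  have h1 : w - x * r - (1 - x) = -x * (r - x⁻¹ * w - (1 - x⁻¹)) := by field_simp; ring
  have h2 : r - ((1 - x) * r + x) * w = -x * (w - ((1 - x⁻¹) * w + x⁻¹) * r) := by
    field_simp; ring
  rw [h1, h2, map_mul B⁻¹, map_mul K⁻¹, MulChar.mul_apply]
  have hB := mulChar_mul_inv_self (χ := B) hx'
  have hK := mulChar_mul_inv_self (χ := K) hx'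
  linear_combination (-(B w * B r * B⁻¹ (r - x⁻¹ * w - (1 - x⁻¹)) *
    K⁻¹ (w - ((1 - x⁻¹) * w + x⁻¹) * r))) * (B (-x) * B⁻¹ (-x) * hK + hB)

theorem dualLineSum_eq {A B K : MulChar F ℂ} (hB : B ≠ 1) (hK : K ≠ 1) (hABK : A * K = B ^ 2)
    {x : F} (hx2 : 2 * x ≠ 1) :
    dualLineSum B K x = ∑ y, K y * B (1 - y) *
      ∑ r, A r * B⁻¹ (r + x * (1 - x) * y * (r - 1) ^ 2) := by
  simp_rw [Finset.mul_sum]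
  rw [Finset.sum_comm]
  refine Finset.sum_congr rfl fun r _ => ?_
  rcases eq_or_ne r 0 with rfl | hr
  · simp [MulChar.map_zero]
  set L : F := ((1 - x) * r + x) * (x * r + (1 - x)) with hL
  trans ∑ w, B r * B w * B⁻¹ (w - L) * K⁻¹ (r - w)
  -- The rescaling of `w` by `(1-x)r+x` fails when this factor vanishes. Then `2x ≠ 1` keeps the
  -- other factor nonzero, and both sides equal `-B(r)K⁻¹(r)`.
  · rcases eq_or_ne ((1 - x) * r + x) 0 with h | h
    · have hβ : x * r + (1 - x) ≠ 0 := by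
        intro h'
        apply hx2
        linear_combination x * h - (1 - x) * h'
      rw [hL, h]
      simp only [zero_mul, sub_zero]
      have e1 : ∀ w, B r * B w * B⁻¹ (w - x * r - (1 - x)) * K⁻¹ r =
          B r * K⁻¹ r * (B w * B⁻¹ (w - (x * r + (1 - x)))) := by
        intro w; rw [sub_sub]; ring
      simp_rw [e1]
      rw [← Finset.mul_sum, sum_mulChar_div_sub hB hβ]
      have e2 : ∑ w, B r * B w * B⁻¹ w * K⁻¹ (r - w) = B r * (∑ w, K⁻¹ (r - w) - K⁻¹ r) := by
        classical
        rw [← Finset.sum_erase_add _ _ (Finset.mem_univ (0 : F)),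
          ← Finset.sum_erase_add Finset.univ (fun w => K⁻¹ (r - w)) (Finset.mem_univ (0 : F))]
        simp only [MulChar.map_zero, mul_zero, zero_mul, add_zero, sub_zero, add_sub_cancel_right]
        rw [Finset.mul_sum]
        refine Finset.sum_congr rfl fun w hw => ?_
        rw [mul_assoc (B r), mulChar_mul_inv_self (Finset.ne_of_mem_erase hw), mul_one]
      have e3 : ∑ w, K⁻¹ (r - w) = ∑ w, K⁻¹ w := Equiv.sum_comp (Equiv.subLeft r) (fun w => K⁻¹ w)
      rw [e2, e3, MulChar.sum_eq_zero_of_ne_one (inv_ne_one.mpr hK)]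
      ring
    · rw [← sum_comp_mul_left (fun w => B r * B w * B⁻¹ (w - L) * K⁻¹ (r - w)) h]
      refine Finset.sum_congr rfl fun w _ => ?_
      rw [hL, ← mul_sub, map_mul, map_mul, sub_sub]
      linear_combination (-B r * B w * B⁻¹ (w - (x * r + (1 - x))) *
        K⁻¹ (r - ((1 - x) * r + x) * w)) * mulChar_mul_inv_self (χ := B) h
  · classical
    rw [← Finset.sum_erase_add _ _ (Finset.mem_univ r),
      ← Finset.sum_erase_add (a := (0 : F)) _ (fun y => K y * _ * _) (Finset.mem_univ _)]
    simp only [sub_self, MulChar.map_zero, mul_zero, zero_mul, add_zero]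
    -- This choice of `y` works because `L = r + x(1-x)(r-1)²`.
    refine Finset.sum_bij' (fun w _ => r / (r - w)) (fun y _ => r - r / y) ?_ ?_ ?_ ?_ ?_
    · intro w hw
      have hw' : r - w ≠ 0 := sub_ne_zero.mpr (Finset.ne_of_mem_erase hw).symm
      exact Finset.mem_erase.mpr ⟨div_ne_zero hr hw', Finset.mem_univ _⟩
    · intro y hy
      have hy' := Finset.ne_of_mem_erase hy
      refine Finset.mem_erase.mpr ⟨fun h => div_ne_zero hr hy' ?_, Finset.mem_univ _⟩
      linear_combination -h
    · intro w hw
      have hw' : r - w ≠ 0 := sub_ne_zero.mpr (Finset.ne_of_mem_erase hw).symm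
      rw [div_div_cancel₀ hr, sub_sub_cancel]
    · intro y hy
      rw [sub_sub_cancel, div_div_cancel₀ hr]
    · intro w hw
      have hw' : r - w ≠ 0 := sub_ne_zero.mpr (Finset.ne_of_mem_erase hw).symm
      have h1 : 1 - r / (r - w) = w * (-(r - w)⁻¹) := by field_simp; ring
      have h2 : r + x * (1 - x) * (r / (r - w)) * (r - 1) ^ 2 =
          (w - L) * r * (-(r - w)⁻¹) := by
        rw [hL]; field_simp; ring
      have hs : -(r - w)⁻¹ ≠ 0 := neg_ne_zero.mpr (inv_ne_zero hw')
      have h3 : A r * K r = B r * B r := by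
        rw [← MulChar.mul_apply, hABK, sq, MulChar.mul_apply]
      rw [h1, h2, div_eq_mul_inv]
      simp only [map_mul, MulChar.inv_apply' K]
      linear_combination (-(K (r - w)⁻¹ * B w * B⁻¹ (w - L))) *
        (B (-(r - w)⁻¹) * B⁻¹ (-(r - w)⁻¹) * B⁻¹ r * h3 +
          B (-(r - w)⁻¹) * B⁻¹ (-(r - w)⁻¹) * B r * mulChar_mul_inv_self (χ := B) hr +
          B r * mulChar_mul_inv_self (χ := B) hs)

/-- The period function in which all lower parameters are squares of upper ones. -/
noncomputable def squarePeriod (A B C : MulChar F ℂ) (t : F) : ℂ :=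
  ∑ y, B (y * (1 - y)) * ∑ z, C (z * (1 - z)) * A⁻¹ (1 - t * z * y)

theorem periodP_eq_squarePeriod (A B C : MulChar F ℂ) (t : F) :
    periodP 2 ![A, B, C] ![B ^ 2, C ^ 2] t = squarePeriod A B C t := by
  have hB : B⁻¹ * B ^ 2 = B := by group
  have hC : C⁻¹ * C ^ 2 = C := by group
  have h : periodP 2 ![A, B, C] ![B ^ 2, C ^ 2] t = ∑ z : F, C z * (C⁻¹ * C ^ 2) (1 - z) *
      ∑ y : F, B y * (B⁻¹ * B ^ 2) (1 - y) * A⁻¹ (1 - t * z * y) := rfl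
  rw [h, hB, hC, squarePeriod]
  simp_rw [Finset.mul_sum]
  rw [Finset.sum_comm]
  refine Finset.sum_congr rfl fun y _ => Finset.sum_congr rfl fun z _ => ?_
  rw [map_mul B, map_mul C]
  ring

variable [DecidableEq F]

theorem exists_squarePeriod_eq (hF : ringChar F ≠ 2) {A B C : MulChar F ℂ} (hA : A ≠ 1)
    (hB : B ≠ 1) (hBA : B ^ 2 * A⁻¹ ≠ 1) (hABC : A = B * C * phi F) :
    ∃ κ : ℂ, ∀ x : F, x ≠ 0 → x ≠ 1 → 2 * x ≠ 1 → squarePeriod A B C (4 * x * (1 - x)) =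
      κ * (B * A⁻¹) (x * (1 - x)) * dualLineSum B (B ^ 2 * A⁻¹) x := by
  obtain ⟨κ, hκ⟩ := exists_quadratic_transformation hF hA hB hABC
  refine ⟨κ, fun x hx0 hx1 hx2 => ?_⟩
  have hm : x * (1 - x) ≠ 0 := mul_ne_zero hx0 (sub_ne_zero.mpr hx1.symm)
  have hK : A * (B ^ 2 * A⁻¹) = B ^ 2 := by rw [mul_comm, inv_mul_cancel_right]
  rw [dualLineSum_eq hB hBA hK hx2, squarePeriod, Finset.mul_sum]
  refine Finset.sum_congr rfl fun y _ => ?_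
  rcases eq_or_ne y 0 with rfl | hy
  · simp [MulChar.map_zero]
  have h := hκ _ (mul_ne_zero hm hy)
  have e : ∀ z, 1 - 4 * x * (1 - x) * z * y = 1 - 4 * (x * (1 - x) * y) * z := fun z => by ring
  simp_rw [e, h]
  rw [map_mul (B * A⁻¹) (x * (1 - x)) y, map_mul B, MulChar.mul_apply B A⁻¹ y,
    MulChar.mul_apply (B ^ 2) A⁻¹ y, sq B, MulChar.mul_apply B B y]
  ring

theorem squarePeriod_transformation (hF : ringChar F ≠ 2) {A B C : MulChar F ℂ} (hA : A ≠ 1)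
    (hB : B ≠ 1) (hBA : B ^ 2 * A⁻¹ ≠ 1) (hABC : A = B * C * phi F)
    {x : F} (hx1 : x ≠ 1) (hxm1 : x ≠ -1) (hx2 : 2 * x ≠ 1) :
    squarePeriod A B C (4 * x * (1 - x)) =
      (A⁻¹ ^ 2) (1 - x) * squarePeriod A B C (-4 * x / (1 - x) ^ 2) := by
  rcases eq_or_ne x 0 with rfl | hx0
  · simp
  obtain ⟨κ, hκ⟩ := exists_squarePeriod_eq hF hA hB hBA hABC
  have hs : 1 - x ≠ 0 := sub_ne_zero.mpr hx1.symm
  -- The same `κ` serves at both points; `x ≠ -1` is the condition `2x ≠ 1` transported to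
  -- `1/(1-x)`.
  have h1 := hκ (1 - x) hs (fun h => hx0 (by linear_combination -h))
    (fun h => hx2 (by linear_combination -h))
  have h2 := hκ (1 - x)⁻¹ (inv_ne_zero hs)
    (fun h => hx0 (by rw [inv_eq_one] at h; linear_combination -h))
    (fun h => hxm1 (by field_simp at h; linear_combination h))
  rw [show 4 * (1 - x) * (1 - (1 - x)) = 4 * x * (1 - x) by ring] at h1
  rw [show 4 * (1 - x)⁻¹ * (1 - (1 - x)⁻¹) = -4 * x / (1 - x) ^ 2 by field_simp; ring,
    dualLineSum_inv B _ hs] at h2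
  rw [h1, h2]
  have e1 : (1 - x) * (1 - (1 - x)) =
      ((1 - x)⁻¹ * (1 - (1 - x)⁻¹)) * ((-(1 - x)) * (-(1 - x)) * (-(1 - x))) := by
    field_simp; ring
  have e2 : (A⁻¹ ^ 2) (1 - x) = A⁻¹ (-(1 - x)) * A⁻¹ (-(1 - x)) := by
    rw [sq, MulChar.mul_apply, ← map_mul, ← map_mul, neg_mul_neg]
  have hA' := mulChar_mul_inv_self (χ := A) (neg_ne_zero.mpr hs)
  rw [e1, e2, map_mul (B * A⁻¹)]
  simp only [map_mul (B * A⁻¹) (-(1 - x)), map_mul (B * A⁻¹) (-(1 - x) * -(1 - x)), sq B,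
    MulChar.mul_apply _ _ (-(1 - x))]
  ring

end Transformation

theorem mainTheorem8 {F : Type*} [Field F] [Fintype F] [DecidableEq F] (hF : ringChar F ≠ 2)
    (A B : MulChar F ℂ) (hA : A ≠ 1) (hB : B ≠ 1)
    (hB2A : B ^ 2 * A⁻¹ ≠ 1) (hB3A2 : B ^ 3 * A⁻¹ ^ 2 ≠ 1)
    (hB3A : B ^ 3 * phi F * A⁻¹ ≠ 1)
    (x : F) (hx1 : x ≠ 1) (hxm1 : x ≠ -1) (hxhalf : x ≠ 1 / 2) :
    hypergeomF 2 ![A, B, A * phi F * B⁻¹] ![B ^ 2, A ^ 2 * B⁻¹ ^ 2] (4 * x * (1 - x)) =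
      (A⁻¹ ^ 2) (1 - x) *
        hypergeomF 2 ![A, B, A * phi F * B⁻¹] ![B ^ 2, A ^ 2 * B⁻¹ ^ 2]
          (-4 * x / (1 - x) ^ 2) := by
  have hC : A ^ 2 * B⁻¹ ^ 2 = (A * phi F * B⁻¹) ^ 2 := by
    rw [mul_pow, mul_pow, sq (phi F), phi_mul_phi, mul_one]
  have hABC : A = B * (A * phi F * B⁻¹) * phi F := by
    rw [mul_comm B, inv_mul_cancel_right, mul_assoc, phi_mul_phi, mul_one]
  have h2 := Ring.two_ne_zero hF
  have hx2 : 2 * x ≠ 1 := fun h => hxhalf (by rw [eq_div_iff h2, mul_comm, h])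
  -- Both sides carry the same Jacobi sum factor, so the identity of periods suffices.
  simp only [hypergeomF]
  rw [hC, periodP_eq_squarePeriod, periodP_eq_squarePeriod,
    squarePeriod_transformation hF hA hB hB2A hABC hx1 hxm1 hx2]
  ring
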